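/- Let $G=(V,E)$ be a directed acyclic graph on a finite set $V$, and let $\Pi$ be a partition of $V$; write $i\sim_\Pi j$ if $i,j$ lie in the same block. Let $\mathrm{pa}(i)$ be the set of parents of $i$ and $\mathrm{de}(i)$ the set of descendants of $i$ (with $i\in\mathrm{de}(i)$). Let $M_{G,\Pi}$ be the set of all matrices $$(I-\Lambda)^{-T}\,\mathrm{diag}(\omega)\,(I-\Lambda)^{-1},$$ where $\Lambda\in\mathbb{R}^{V\times V}$ satisfies $\lambda_{ij}=0$ whenever $i\to j\notin E$, and $\omega\in(0,\infty)^V$ satisfies $\omega_i=\omega_j$ whenever $i\sim_\Pi j$. For $S\subseteq V$ and distinct $i,j\in V\setminus S$, say that $i$ and $j$ are d-separated by $S$ in $G$ if there is no path from $i$ to $j$ (a sequence of consecutively adjacent nodes joined by edges of either direction, repetitions allowed) all of whose colliders lie in $S$ and all of whose interior non-colliders lie outside $S$; here an interior occurrence of a node on the path is a collider if both path edges next to it point to it. Then a real positive definite matrix $\Sigma=(\sigma_{ij})\in\mathbb{R}^{V\times V}$ lies in $M_{G,\Pi}$ if and only if it satisfies both of the following. 1. (Conditional independence constraints.) $\det(\Sigma_{\{i\}\cup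 S,\,\{j\}\cup S})=0$ for all distinct $i,j\in V$ and all $S\subseteq V\setminus\{i,j\}$ such that $i$ and $j$ are d-separated by $S$ in $G$. (The rows and columns are ordered with $i$, respectively $j$, first, followed by $S$ in one common order.) 2. (Equal variance constraints.) For all distinct $i,j\in V$ with $i\sim_\Pi j$ and all subsets $A_i,A_j$ with $\mathrm{pa}(i)\subseteq A_i\subseteq V\setminus\mathrm{de}(i)$ and $\mathrm{pa}(j)\subseteq A_j\subseteq V\setminus\mathrm{de}(j)$, $$\sigma_{ii}-\Sigma_{i,A_i}(\Sigma_{A_i,A_i})^{-1}\Sigma_{A_i,i}=\sigma_{jj}-\Sigma_{j,A_j}(\Sigma_{A_j,A_j})^{-1}\Sigma_{A_j,j}.$$ -/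

import Mathlib

namespace PartialHomoscedastic

universe u

section Graph

variable {V : Type u}

/-- The parents of `i`: all `k` with an edge `k → i` (where `G.Adj k i` is read as `k → i`). -/
def parents (G : Digraph V) (i : V) : Set V := {k | G.Adj k i}

/-- The descendants of `i`: all nodes reachable from `i` by a directed path, including `i` itself. -/
def descendants (G : Digraph V) (i : V) : Set V := {k | Relation.ReflTransGen G.Adj i k}

/-- A directed graph is acyclic if no node lies on a directed cycle (of length at least one). In
particular, there are no loops. -/
def IsDAG (G : Digraph V) : Prop := ∀ i, ¬ Relation.TransGen G.Adj i i

/-- A path is an alternating sequence of nodes and edges in which each edge joins the two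
neighbouring nodes, in either direction. Nodes and edges may be repeated. -/
inductive GPath (G : Digraph V) : V → V → Type u
  | nil (a : V) : GPath G a a
  /-- a path that starts with `a → b` -/
  | fwd {a b c : V} (h : G.Adj a b) (p : GPath G b c) : GPath G a c
  /-- a path that starts with `a ← b` -/
  | bwd {a b c : V} (h : G.Adj b a) (p : GPath G b c) : GPath G a c

namespace GPath

variable {G : Digraph V}

/-- The interior occurrences of nodes on the path at which both adjacent edges point to the node,
`· → b ← ·`. -/
def colliders : {a c : V} → GPath G a c → List V
  | _, _, nil _ => []
  | _, _, fwd _ (nil _) => []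
  | _, _, fwd _ (fwd h p) => colliders (fwd h p)
  | _, _, fwd (b := b) _ (bwd h p) => b :: colliders (bwd h p)
  | _, _, bwd _ p => colliders p

/-- The interior occurrences of nodes on the path that are not colliders:
`· → b → ·`, `· ← b → ·` and `· ← b ← ·`. -/
def nonColliders : {a c : V} → GPath G a c → List V
  | _, _, nil _ => []
  | _, _, fwd _ (nil _) => []
  | _, _, fwd (b := b) _ (fwd h p) => b :: nonColliders (fwd h p)
  | _, _, fwd _ (bwd h p) => nonColliders (bwd h p)
  | _, _, bwd _ (nil _) => []
  | _, _, bwd (b := b) _ (fwd h p) => b :: nonColliders (fwd h p)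
  | _, _, bwd (b := b) _ (bwd h p) => b :: nonColliders (bwd h p)

end GPath

/-- `i` and `j` are d-connected by `S` if some path from `i` to `j` has all its colliders in `S`
and all its non-colliders outside `S`. (Used only for `i, j ∉ S`.) -/
def DConnected (G : Digraph V) (i j : V) (S : Finset V) : Prop :=
  ∃ p : GPath G i j, (∀ k ∈ p.colliders, k ∈ S) ∧ (∀ k ∈ p.nonColliders, k ∉ S)

/-- `i` and `j` are d-separated by `S` if they are not d-connected by `S`. -/
def DSeparated (G : Digraph V) (i j : V) (S : Finset V) : Prop := ¬ DConnected G i j S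

end Graph

section Model

variable {V : Type u} [Fintype V] [DecidableEq V]

/-- `i` and `j` lie in the same block of the partition `P` of the vertex set. -/
def SameBlock (P : Finpartition (Finset.univ : Finset V)) (i j : V) : Prop :=
  ∃ B ∈ P.parts, i ∈ B ∧ j ∈ B

/-- The real `V × V` matrices whose support is contained in the edge set of `G`. -/
def edgeMatrices (G : Digraph V) : Set (Matrix V V ℝ) :=
  {L | ∀ i j, ¬ G.Adj i j → L i j = 0}

/-- The covariance matrix `(I - Λ)⁻ᵀ diag(ω) (I - Λ)⁻¹` of the linear structural equation model
`X = Λᵀ X + ε` with independent errors of variances `ω`. For a DAG `G` and `Λ ∈ edgeMatrices G`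
the matrix `I - Λ` is invertible. -/
noncomputable def covariance (L : Matrix V V ℝ) (w : V → ℝ) : Matrix V V ℝ :=
  ((1 - L)⁻¹).transpose * Matrix.diagonal w * (1 - L)⁻¹

/-- The covariance matrices of the partially homoscedastic linear Gaussian model of `(G, P)`. -/
def model (G : Digraph V) (P : Finpartition (Finset.univ : Finset V)) : Set (Matrix V V ℝ) :=
  {C | ∃ L ∈ edgeMatrices G, ∃ w : V → ℝ,
    (∀ i, 0 < w i) ∧ (∀ i j, SameBlock P i j → w i = w j) ∧ C = covariance L w}

end Model

section Constraints

variable {V : Type u} [DecidableEq V]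

/-- The submatrix of `C` with rows `i, S` and columns `j, S`. -/
def borderedSubmatrix (C : Matrix V V ℝ) (i j : V) (S : Finset V) :
    Matrix (Unit ⊕ S) (Unit ⊕ S) ℝ :=
  C.submatrix (Sum.elim (fun _ => i) (fun s => (s : V))) (Sum.elim (fun _ => j) (fun s => (s : V)))

/-- The conditional variance `C_{ii} - C_{i,A} (C_{A,A})⁻¹ C_{A,i}` of `i` given `A`. -/
noncomputable def condVariance (C : Matrix V V ℝ) (i : V) (A : Finset V) : ℝ :=
  C i i - (fun a : A => C i a) ⬝ᵥ
    ((C.submatrix (fun a : A => (a : V)) (fun a : A => (a : V)))⁻¹.mulVec (fun a : A => C a i))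

end Constraints

end PartialHomoscedastic

namespace PartialHomoscedastic

universe v

/-! ### Acyclicity, d-separation by parents, and Bayes ball moves. -/

section Graph

variable {V : Type v} {G : Digraph V}

/-! Regression is encoded by its normal equations, whose solution is unique because `C` is positive
definite. By `det_borderedSubmatrix_eq_zero_iff`, the determinant for `i, j, S` vanishes iff
variable `i` is uncorrelated with the residual of `j` regressed on `S`.

For a matrix of the model, let `a` be the coefficients of (minus) that residual, `b` its covariances
with the variables and `c` its coefficients in the errors. The nodes joined to `j` by open paths are
closed under Bayes ball moves, and `eq_zero_of_bayesBall` shows `b = 0` off them and off `S`: a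
truncated pairing of `b` with `c` shows that a weighted sum of squares of coefficients of `c`
vanishes. Moreover, the error of `i` is uncorrelated with the non-descendants of `i`, so column `i`
of `L` solves the normal equations for every admissible `A`, and the conditional variance is `w i`
(`condVariance_covariance`).

Conversely, only conditioning on parents matters. Parents d-separate a node from its other
non-descendants (`IsDAG.dSeparated_parents`), so regressing each variable on its parents leaves
uncorrelated residuals (`exists_eq_covariance`). Their variances are constant on blocks by the
second constraint. -/

theorem IsDAG.wellFounded_adj [Finite V] (hG : IsDAG G) : WellFounded G.Adj := by
  have : Std.Irrefl (Relation.TransGen G.Adj) := ⟨hG⟩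
  exact Subrelation.wf (r := Relation.TransGen G.Adj) (fun h => .single h)
    (Finite.wellFounded_of_trans_of_irrefl _)

theorem IsDAG.wellFounded_swap_adj [Finite V] (hG : IsDAG G) :
    WellFounded (fun x y => G.Adj y x) := by
  have : Std.Irrefl (Function.swap (Relation.TransGen G.Adj)) := ⟨hG⟩
  have : IsTrans V (Function.swap (Relation.TransGen G.Adj)) :=
    ⟨fun _ _ _ h h' => Relation.TransGen.trans h' h⟩
  exact Subrelation.wf (r := Function.swap (Relation.TransGen G.Adj)) (fun h => .single h)
    (Finite.wellFounded_of_trans_of_irrefl _)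

theorem IsDAG.notMem_descendants_of_mem_parents (hG : IsDAG G) {i k : V}
    (hk : k ∈ parents G i) : k ∉ descendants G i := fun h =>
  hG i (Relation.TransGen.tail' h hk)

theorem notMem_descendants_of_adj {i k p : V} (hk : k ∉ descendants G i) (hp : G.Adj p k) :
    p ∉ descendants G i := fun h => hk (Relation.ReflTransGen.tail h hp)

theorem IsDAG.notMem_descendants_symm (hG : IsDAG G) {i j : V} (hij : i ≠ j)
    (hj : j ∈ descendants G i) : i ∉ descendants G j := by
  intro hi
  rcases Relation.reflTransGen_iff_eq_or_transGen.1 hj with h | h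
  · exact hij h.symm
  · exact hG i (h.trans_left hi)

/-- All colliders of the path lie in `S` and all its non-colliders outside `S`. -/
def GPath.IsOpen {a c : V} (p : GPath G a c) (S : Finset V) : Prop :=
  (∀ k ∈ p.colliders, k ∈ S) ∧ ∀ k ∈ p.nonColliders, k ∉ S

/-- An open path that enters a descendant of `i` through an arrow pointing to it can only visit
descendants of `i`, if all conditioned nodes are parents of `i`. -/
theorem IsDAG.mem_descendants_of_isOpen_fwd (hG : IsDAG G) {i : V} {S : Finset V}
    (hS : (S : Set V) ⊆ parents G i) {a j : V} (p : GPath G a j) :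
    ∀ {x : V} (h : G.Adj x a), (GPath.fwd h p).IsOpen S → a ∈ descendants G i →
      j ∈ descendants G i := by
  induction p with
  | nil a => exact fun _ _ ha => ha
  | fwd h' p ih =>
    intro x h ho ha
    refine ih h' ⟨fun k hk => ho.1 k ?_, fun k hk => ho.2 k ?_⟩ (Relation.ReflTransGen.tail ha h')
    · simpa [GPath.colliders] using hk
    · simp [GPath.nonColliders, hk]
  -- The node is a collider, so it lies in `S`, but a parent of `i` cannot be a descendant of `i`.
  | bwd h' p ih =>
    intro x h ho ha
    exact absurd ha (hG.notMem_descendants_of_mem_parents (hS (ho.1 _ List.mem_cons_self)))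

/-- The directed local Markov property of d-separation. -/
theorem IsDAG.dSeparated_parents (hG : IsDAG G) {i j : V} {S : Finset V}
    (hS : (S : Set V) = parents G i) (hij : i ≠ j) (hjS : j ∉ S) (hj : j ∉ descendants G i) :
    DSeparated G i j S := by
  rintro ⟨p, hp⟩
  cases p with
  | nil => exact hij rfl
  | fwd h p =>
    exact hj (hG.mem_descendants_of_isOpen_fwd hS.le p h hp (Relation.ReflTransGen.single h))
  | @bwd _ b _ h p =>
    have hb : b ∈ S := by
      rw [← Finset.mem_coe, hS]
      exact h
    cases p with
    | nil => exact hjS hb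
    | fwd h' p => exact hp.2 b (by simp [GPath.nonColliders]) hb
    | bwd h' p => exact hp.2 b (by simp [GPath.nonColliders]) hb

/-- The nodes with an open path to `i` that starts along an outgoing edge, and `i` itself. -/
def openOut (G : Digraph V) (i : V) (S : Finset V) : Set V :=
  {k | k = i ∨ ∃ (m : V) (h : G.Adj k m) (p : GPath G m i), (GPath.fwd h p).IsOpen S}

/-- The nodes with an open path to `i` that starts along an incoming edge. -/
def openIn (G : Digraph V) (i : V) (S : Finset V) : Set V :=
  {k | ∃ (m : V) (h : G.Adj m k) (p : GPath G m i), (GPath.bwd h p).IsOpen S}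

theorem dConnected_of_mem_openOut {i k : V} {S : Finset V} (hk : k ∈ openOut G i S) :
    DConnected G k i S := by
  rcases hk with rfl | ⟨m, h, p, hp⟩
  · exact ⟨.nil _, by simp [GPath.colliders], by simp [GPath.nonColliders]⟩
  · exact ⟨_, hp⟩

theorem dConnected_of_mem_openIn {i k : V} {S : Finset V} (hk : k ∈ openIn G i S) :
    DConnected G k i S := by
  obtain ⟨m, h, p, hp⟩ := hk
  exact ⟨_, hp⟩

/-- Prepending an edge makes the old first node interior, and the two edge directions decide whether
it must lie in `S`. This and the next three lemmas are the closure hypotheses of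
`eq_zero_of_bayesBall`. -/
theorem mem_openOut_of_adj_openOut {i k m : V} {S : Finset V} (hk : k ∈ openOut G i S)
    (hkS : k ∉ S) (h : G.Adj m k) : m ∈ openOut G i S := by
  rcases hk with rfl | ⟨n, h', p, hp⟩
  · exact Or.inr ⟨k, h, .nil k, by simp [GPath.colliders], by simp [GPath.nonColliders]⟩
  · refine Or.inr ⟨k, h, .fwd h' p, ?_, ?_⟩
    · simpa [GPath.colliders] using hp.1
    · simpa [GPath.nonColliders, hkS] using hp.2

theorem mem_openIn_of_openOut_adj {i k m : V} {S : Finset V} (hk : k ∈ openOut G i S)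
    (hkS : k ∉ S) (h : G.Adj k m) : m ∈ openIn G i S := by
  rcases hk with rfl | ⟨n, h', p, hp⟩
  · exact ⟨k, h, .nil k, by simp [GPath.colliders], by simp [GPath.nonColliders]⟩
  · refine ⟨k, h, .fwd h' p, ?_, ?_⟩
    · simpa [GPath.colliders] using hp.1
    · simpa [GPath.nonColliders, hkS] using hp.2

theorem mem_openIn_of_openIn_adj {i k m : V} {S : Finset V} (hk : k ∈ openIn G i S)
    (hkS : k ∉ S) (h : G.Adj k m) : m ∈ openIn G i S := by
  obtain ⟨n, h', p, hp⟩ := hk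
  refine ⟨k, h, .bwd h' p, ?_, ?_⟩
  · simpa [GPath.colliders] using hp.1
  · simpa [GPath.nonColliders, hkS] using hp.2

theorem mem_openOut_of_adj_openIn {i k m : V} {S : Finset V} (hk : k ∈ openIn G i S)
    (hkS : k ∈ S) (h : G.Adj m k) : m ∈ openOut G i S := by
  obtain ⟨n, h', p, hp⟩ := hk
  refine Or.inr ⟨k, h, .bwd h' p, ?_, ?_⟩
  · simpa [GPath.colliders, hkS] using hp.1
  · simpa [GPath.nonColliders] using hp.2

end Graph

/-! ### Vanishing covariances at nodes missed by the Bayes ball. -/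

section Markov

variable {V : Type v} [Fintype V] {G : Digraph V}

/-- Let `U` and `D` be closed under the steps of the Bayes ball algorithm, and let `a` be the
coefficients of a linear combination of the variables indexed by `U` and `S` that is uncorrelated
with the variables in `S`. With `c` its coefficients in terms of the errors and `b` its covariances
with all variables, `b` vanishes at the nodes that are not reached. -/
theorem eq_zero_of_bayesBall (hG : IsDAG G) {L : Matrix V V ℝ}
    (hL : L ∈ edgeMatrices G) {w : V → ℝ} (hw : ∀ i, 0 < w i) {U D S : Set V}
    (hUU : ∀ k m, k ∈ U → k ∉ S → G.Adj m k → m ∈ U)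
    (hUD : ∀ k m, k ∈ U → k ∉ S → G.Adj k m → m ∈ D)
    (hDD : ∀ k m, k ∈ D → k ∉ S → G.Adj k m → m ∈ D)
    (hDU : ∀ k m, k ∈ D → k ∈ S → G.Adj m k → m ∈ U)
    {a b c : V → ℝ} (ha : ∀ k, k ∉ U → k ∉ S → a k = 0) (hbS : ∀ k ∈ S, b k = 0)
    (hb : ∀ k, b k = ∑ p, L p k * b p + w k * c k)
    (hc : ∀ k, c k = ∑ m, L k m * c m + a k)
    {j : V} (hjS : j ∉ S) (hjU : j ∉ U) (hjD : j ∉ D) : b j = 0 := by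
  classical
  have hadj : ∀ {p k}, L p k ≠ 0 → G.Adj p k := fun {p k} h => by
    by_contra h'
    exact h (hL p k h')
  -- Every child of such a node is of the same kind, since otherwise `hDU` or `hUU` would put the
  -- node in `U`. Hence the induction runs up from the sinks.
  have hF : ∀ k, k ∈ D → k ∉ U → k ∉ S → c k = 0 := by
    intro k
    induction k using hG.wellFounded_swap_adj.induction with
    | _ k ih =>
      intro hD hU hS
      rw [hc k, ha k hU hS, add_zero]
      refine Finset.sum_eq_zero fun m _ => ?_
      by_cases hm : L k m = 0
      · rw [hm, zero_mul]
      have hm := hadj hm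
      have hmD := hDD k m hD hS hm
      have hmS : m ∉ S := fun h => hU (hDU m k hmD h hm)
      rw [ih m hm hmD (fun h => hU (hUU m k h hmS hm)) hmS, mul_zero]
  -- `N` is the set of unreached nodes outside `S`, and `Q` adds the nodes of `S` outside `D`. For
  -- an edge from `p` into `Q`, either `p` is in `N` or `b p = 0`. For an edge from `N` to `k`,
  -- either `k` is in `Q` or `c k = 0`.
  set Q : V → Prop := fun k => k ∉ D ∧ (k ∉ S → k ∉ U)
  set N : V → Prop := fun k => k ∉ S ∧ k ∉ U ∧ k ∉ D
  have hNQ : ∀ {k}, N k → Q k := fun h => ⟨h.2.2, fun _ => h.2.1⟩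
  have hpar : ∀ p k, G.Adj p k → Q k → ¬ N p → b p = 0 := by
    intro p k h hk hp
    by_cases hpS : p ∈ S
    · exact hbS p hpS
    · exact absurd ⟨hpS, fun hU => hk.1 (hUD p k hU hpS h), fun hD => hk.1 (hDD p k hD hpS h)⟩ hp
  have hchild : ∀ p k, G.Adj p k → N p → ¬ Q k → c k = 0 := by
    intro p k h hp hk
    by_cases hkS : k ∈ S
    · exact absurd ⟨fun hD => hp.2.1 (hDU k p hD hkS h), fun h' => absurd hkS h'⟩ hk
    · have hkU : k ∉ U := fun hU => hp.2.1 (hUU k p hU hkS h)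
      by_cases hkD : k ∈ D
      · exact hF k hkD hkU hkS
      · exact absurd ⟨hkD, fun _ => hkU⟩ hk
  set c' : V → ℝ := fun k => if Q k then c k else 0 with hc'
  set b' : V → ℝ := fun k => if N k then b k else 0 with hb'
  have key : ∀ p k, c' k * (L p k * b p) = b' p * (L p k * c k) := by
    intro p k
    by_cases hpk : L p k = 0
    · simp [hpk]
    have hpk := hadj hpk
    by_cases hk : Q k <;> by_cases hp : N p
    · simp only [hc', hb', hk, hp, if_true]; ring
    · simp [hb', hp, hpar p k hpk hk hp]
    · simp [hc', hk, hchild p k hpk hp hk]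
    · simp [hc', hb', hk, hp]
  have hcb : ∀ k, c' k * b k = b' k * c k := by
    intro k
    by_cases hk : N k
    · simp only [hc', hb', hk, hNQ hk, if_true]; ring
    · by_cases hk' : Q k
      · have : b k = 0 := by
          by_contra h
          have hkS : k ∉ S := fun h' => h (hbS k h')
          exact hk ⟨hkS, hk'.2 hkS, hk'.1⟩
        simp [hb', hk, this]
      · simp [hc', hb', hk, hk']
  -- Substituting `hb` and exchanging sums by `key` leaves the sum of `b' p * a p`, which is zero
  -- because `a` vanishes on `N`.
  have hE : ∑ k, c' k * (w k * c k) = 0 := by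
    have h1 : ∀ k, c' k * (w k * c k) = b' k * c k - ∑ p, c' k * (L p k * b p) := by
      intro k
      rw [← Finset.mul_sum, ← hcb, ← mul_sub]
      congr 1
      linarith [hb k]
    have h2 : ∀ p, ∑ k, b' p * (L p k * c k) = b' p * c p := by
      intro p
      rw [← Finset.mul_sum]
      by_cases hp : N p
      · congr 1
        have := hc p
        rw [ha p hp.2.1 hp.1] at this
        linarith
      · simp [hb', hp]
    rw [Finset.sum_congr rfl fun k _ => h1 k, Finset.sum_sub_distrib, Finset.sum_comm,
      Finset.sum_congr rfl fun p _ => (Finset.sum_congr rfl fun k _ => key p k).trans (h2 p),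
      sub_self]
  have hcQ : ∀ k, Q k → c k = 0 := by
    have hnn : ∀ k ∈ Finset.univ, 0 ≤ c' k * (w k * c k) := by
      intro k _
      by_cases hk : Q k
      · simp only [hc', hk, if_true]
        nlinarith [mul_nonneg (hw k).le (mul_self_nonneg (c k))]
      · simp [hc', hk]
    intro k hk
    have := (Finset.sum_eq_zero_iff_of_nonneg hnn).1 hE k (Finset.mem_univ k)
    simpa [hc', hk, (hw k).ne'] using this
  have hbN : ∀ k, N k → b k = 0 := by
    intro k
    induction k using hG.wellFounded_adj.induction with
    | _ k ih =>
      intro hk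
      rw [hb k, hcQ k (hNQ hk), mul_zero, add_zero]
      refine Finset.sum_eq_zero fun p _ => ?_
      by_cases hp : L p k = 0
      · rw [hp, zero_mul]
      have hp := hadj hp
      by_cases hNp : N p
      · rw [ih p hp hNp, mul_zero]
      · rw [hpar p k hp (hNQ hk) hNp, mul_zero]
  exact hbN j ⟨hjS, hjU, hjD⟩

end Markov

/-! ### Normal equations and bordered determinants. -/

section Regression

variable {V : Type v} {C : Matrix V V ℝ}

theorem submatrix_subtype_isUnit_det [DecidableEq V] (hC : C.PosDef) (A : Finset V) :
    IsUnit (C.submatrix (fun a : A => (a : V)) (fun a : A => (a : V))).det :=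
  (Matrix.isUnit_iff_isUnit_det _).1 (hC.submatrix Subtype.val_injective).isUnit

theorem sum_mul_eq_sum_subtype [Fintype V] {A : Finset V} {f : V → ℝ}
    (hf : ∀ k ∉ A, f k = 0) (g : V → ℝ) :
    ∑ k, g k * f k = ∑ k : A, g k * f k := by
  rw [Finset.sum_coe_sort A (fun k => g k * f k)]
  refine (Finset.sum_subset (Finset.subset_univ A) fun k _ hk => ?_).symm
  rw [hf k hk, mul_zero]

/-- The coefficients of the regression of variable `i` on the variables in `A`. -/
noncomputable def regression [DecidableEq V] (C : Matrix V V ℝ) (i : V) (A : Finset V) (k : V) :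
    ℝ :=
  if h : k ∈ A then
    ((C.submatrix (fun a : A => (a : V)) (fun a : A => (a : V)))⁻¹.mulVec (fun a : A => C a i))
      ⟨k, h⟩
  else 0

theorem regression_of_notMem [DecidableEq V] {i k : V} {A : Finset V} (hk : k ∉ A) :
    regression C i A k = 0 :=
  dif_neg hk

variable [Fintype V] [DecidableEq V]

theorem sum_mul_regression (hC : C.PosDef) (i : V) {A : Finset V} {k : V} (hk : k ∈ A) :
    ∑ m, C k m * regression C i A m = C k i := by
  rw [sum_mul_eq_sum_subtype (fun _ => regression_of_notMem)]
  have h : (C.submatrix (fun a : A => (a : V)) (fun a : A => (a : V))).mulVec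
      ((C.submatrix (fun a : A => (a : V)) (fun a : A => (a : V)))⁻¹.mulVec
        (fun a : A => C a i)) = fun a : A => C a i := by
    rw [Matrix.mulVec_mulVec, Matrix.mul_nonsing_inv _ (submatrix_subtype_isUnit_det hC A),
      Matrix.one_mulVec]
  have h := congrFun h ⟨k, hk⟩
  simpa [Matrix.mulVec, dotProduct, regression] using h

theorem eq_regression (hC : C.PosDef) {i : V} {A : Finset V} {f : V → ℝ}
    (hf : ∀ k ∉ A, f k = 0) (h : ∀ k ∈ A, ∑ m, C k m * f m = C k i) :
    f = regression C i A := by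
  have h' : (C.submatrix (fun a : A => (a : V)) (fun a : A => (a : V))).mulVec
      (fun a : A => f a) = fun a : A => C a i := by
    ext k
    rw [← h k k.2, sum_mul_eq_sum_subtype hf]
    rfl
  funext k
  by_cases hk : k ∈ A
  · rw [regression, dif_pos hk, ← h', Matrix.mulVec_mulVec,
      Matrix.nonsing_inv_mul _ (submatrix_subtype_isUnit_det hC A), Matrix.one_mulVec]
  · rw [hf k hk, regression_of_notMem hk]

theorem condVariance_eq (i : V) (A : Finset V) :
    condVariance C i A = C i i - ∑ m, C i m * regression C i A m := by
  rw [sum_mul_eq_sum_subtype (fun _ => regression_of_notMem)]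
  simp [condVariance, regression, dotProduct]

theorem borderedSubmatrix_mulVec_regression (i j : V) (S : Finset V) (k : Unit ⊕ S) :
    (borderedSubmatrix C i j S).mulVec (Sum.elim (fun _ => -1) (fun s => regression C j S s)) k =
      ∑ m, C (Sum.elim (fun _ => i) (fun s : S => (s : V)) k) m * regression C j S m -
        C (Sum.elim (fun _ => i) (fun s : S => (s : V)) k) j := by
  rw [sum_mul_eq_sum_subtype (fun _ => regression_of_notMem)]
  simp [borderedSubmatrix, Matrix.mulVec, dotProduct, neg_add_eq_sub]

/-- Since the `S`-block is invertible, a nonzero kernel vector has a nonzero entry at `j`. Scaled to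
make this entry `-1`, it is the regression vector on `S`, and row `i` is the only remaining
equation. -/
theorem det_borderedSubmatrix_eq_zero_iff (hC : C.PosDef) (i j : V) (S : Finset V) :
    (borderedSubmatrix C i j S).det = 0 ↔ ∑ m, C i m * regression C j S m = C i j := by
  constructor
  · intro h
    obtain ⟨v, hv, hv0⟩ := Matrix.exists_mulVec_eq_zero_iff.2 h
    set y := v (Sum.inl ())
    set f : V → ℝ := fun k => if h : k ∈ S then v (Sum.inr ⟨k, h⟩) else 0
    have hfS : ∀ k ∉ S, f k = 0 := fun k hk => dif_neg hk
    have hfv : ∀ s : S, f s = v (Sum.inr s) := fun s => dif_pos s.2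
    have hsum : ∀ k : Unit ⊕ S, C (Sum.elim (fun _ => i) (fun s : S => (s : V)) k) j * y +
        ∑ m, C (Sum.elim (fun _ => i) (fun s : S => (s : V)) k) m * f m = 0 := by
      intro k
      rw [sum_mul_eq_sum_subtype hfS]
      simpa [borderedSubmatrix, Matrix.mulVec, dotProduct, hfv] using congrFun hv0 k
    -- Adding a solution of the homogeneous equations to the regression gives another solution of
    -- the normal equations.
    have hreg : ∀ g : V → ℝ, (∀ k ∉ S, g k = 0) → (∀ k ∈ S, ∑ m, C k m * g m = 0) → g = 0 := by
      intro g hg hg'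
      have h1 : (regression C j S + g) = regression C j S := by
        refine eq_regression hC (fun k hk => ?_) fun k hk => ?_
        · simp [hg k hk, regression_of_notMem hk]
        · simp only [Pi.add_apply, mul_add, Finset.sum_add_distrib, hg' k hk,
            sum_mul_regression hC j hk, add_zero]
      simpa using h1
    have hfr : f = fun k => -y * regression C j S k := by
      have := hreg (fun k => f k + y * regression C j S k) (fun k hk => by
        simp [hfS k hk, regression_of_notMem hk]) fun k hk => by
          have h1 := hsum (Sum.inr ⟨k, hk⟩)
          simp only [Sum.elim_inr] at h1
          simp only [mul_add, Finset.sum_add_distrib, mul_left_comm _ y, ← Finset.mul_sum,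
            sum_mul_regression hC j hk]
          linarith
      funext k
      have := congrFun this k
      simp only [Pi.zero_apply] at this
      linarith
    have hy0 : y ≠ 0 := by
      intro h0
      apply hv
      funext k
      rcases k with ⟨⟩ | s
      · exact h0
      · rw [← hfv, hfr, h0]
        simp
    have h1 := hsum (Sum.inl ())
    rw [hfr] at h1
    simp only [Sum.elim_inl, mul_left_comm _ (-y), ← Finset.mul_sum] at h1
    exact mul_left_cancel₀ hy0 (by linarith)
  · intro h
    refine Matrix.exists_mulVec_eq_zero_iff.1
      ⟨Sum.elim (fun _ => -1) (fun s => regression C j S s), fun h0 => ?_, ?_⟩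
    · simpa using congrFun h0 (Sum.inl ())
    · funext k
      rw [borderedSubmatrix_mulVec_regression]
      rcases k with ⟨⟩ | s
      · simp [h]
      · simp [sum_mul_regression hC j s.2]

end Regression

/-! ### Structural equations: necessity and reconstruction. -/

section Model

variable {V : Type v} [Fintype V] [DecidableEq V] {G : Digraph V} {L : Matrix V V ℝ}

/-- Each entry of a kernel vector is a combination of the entries at the children, so it vanishes by
induction from the sinks. -/
theorem isUnit_det_one_sub (hG : IsDAG G) (hL : L ∈ edgeMatrices G) : IsUnit (1 - L).det := by
  rw [isUnit_iff_ne_zero]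
  intro h
  obtain ⟨v, hv, hv0⟩ := Matrix.exists_mulVec_eq_zero_iff.2 h
  apply hv
  funext k
  induction k using hG.wellFounded_swap_adj.induction with
  | _ k ih =>
    have h1 := congrFun hv0 k
    rw [Matrix.sub_mulVec, Matrix.one_mulVec, Pi.sub_apply, Pi.zero_apply, sub_eq_zero] at h1
    rw [h1]
    refine Finset.sum_eq_zero fun m _ => ?_
    by_cases hm : G.Adj k m
    · exact mul_eq_zero_of_right _ (ih m hm)
    · exact mul_eq_zero_of_left (hL k m hm) _

theorem transpose_mul_covariance (hG : IsDAG G) (hL : L ∈ edgeMatrices G) (w : V → ℝ) :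
    (1 - L).transpose * covariance L w = Matrix.diagonal w * (1 - L)⁻¹ := by
  rw [covariance, ← Matrix.mul_assoc, ← Matrix.mul_assoc, ← Matrix.transpose_mul,
    Matrix.nonsing_inv_mul _ (isUnit_det_one_sub hG hL), Matrix.transpose_one, Matrix.one_mul]

theorem eq_covariance_of_transpose_mul_mul (hG : IsDAG G) (hL : L ∈ edgeMatrices G)
    {C : Matrix V V ℝ} {w : V → ℝ}
    (h : (1 - L).transpose * C * (1 - L) = Matrix.diagonal w) : C = covariance L w := by
  have hu := isUnit_det_one_sub hG hL
  calc C = ((1 - L) * (1 - L)⁻¹).transpose * C * ((1 - L) * (1 - L)⁻¹) := by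
        rw [Matrix.mul_nonsing_inv _ hu, Matrix.transpose_one, Matrix.one_mul, Matrix.mul_one]
    _ = ((1 - L)⁻¹).transpose * ((1 - L).transpose * C * (1 - L)) * (1 - L)⁻¹ := by
        simp only [Matrix.transpose_mul, Matrix.mul_assoc]
    _ = covariance L w := by rw [h, covariance]

/-- The global Markov property. -/
theorem det_borderedSubmatrix_eq_zero_of_dSeparated (hG : IsDAG G) (hL : L ∈ edgeMatrices G)
    {w : V → ℝ} (hw : ∀ i, 0 < w i) (hC : (covariance L w).PosDef) {i j : V} {S : Finset V}
    (hi : i ∉ S) (h : DSeparated G i j S) :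
    (borderedSubmatrix (covariance L w) i j S).det = 0 := by
  rw [det_borderedSubmatrix_eq_zero_iff hC]
  have hu := isUnit_det_one_sub hG hL
  set a : V → ℝ := regression (covariance L w) j S - Pi.single j 1 with ha
  have hCa : ∀ k, (covariance L w).mulVec a k =
      ∑ m, covariance L w k m * regression (covariance L w) j S m - covariance L w k j := by
    intro k
    rw [ha, Matrix.mulVec_sub, Pi.sub_apply, Matrix.mulVec_single_one]
    rfl
  rw [← sub_eq_zero, ← hCa]
  refine eq_zero_of_bayesBall hG hL hw (S := (S : Set V)) (U := openOut G j S)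
    (D := openIn G j S) (a := a) (c := (1 - L)⁻¹.mulVec a)
    (fun _ _ => mem_openOut_of_adj_openOut) (fun _ _ => mem_openIn_of_openOut_adj)
    (fun _ _ => mem_openIn_of_openIn_adj) (fun _ _ => mem_openOut_of_adj_openIn)
    ?_ ?_ ?_ ?_ hi (fun h' => h (dConnected_of_mem_openOut h'))
    (fun h' => h (dConnected_of_mem_openIn h'))
  · intro k hkU hkS
    have hkj : k ≠ j := fun h' => hkU (Or.inl h')
    simp [ha, regression_of_notMem (show k ∉ S from hkS), hkj]
  · intro k hk
    rw [hCa, sum_mul_regression hC j hk, sub_self]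
  · intro k
    have h1 : (1 - L).transpose.mulVec ((covariance L w).mulVec a) =
        (Matrix.diagonal w).mulVec ((1 - L)⁻¹.mulVec a) := by
      rw [Matrix.mulVec_mulVec, transpose_mul_covariance hG hL, Matrix.mulVec_mulVec]
    have h2 := congrFun h1 k
    rw [Matrix.mulVec_diagonal, Matrix.transpose_sub, Matrix.sub_mulVec, Matrix.transpose_one,
      Matrix.one_mulVec, Pi.sub_apply, sub_eq_iff_eq_add'] at h2
    exact h2
  · intro k
    have h1 : (1 - L).mulVec ((1 - L)⁻¹.mulVec a) = a := by
      rw [Matrix.mulVec_mulVec, Matrix.mul_nonsing_inv _ hu, Matrix.one_mulVec]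
    have h2 := congrFun h1 k
    rw [Matrix.sub_mulVec, Matrix.one_mulVec, Pi.sub_apply, sub_eq_iff_eq_add'] at h2
    exact h2

/-- The conditional variance of `i` given a set of non-descendants that contains its parents is the
variance of the error. -/
theorem condVariance_covariance (hG : IsDAG G) (hL : L ∈ edgeMatrices G) {w : V → ℝ}
    (hC : (covariance L w).PosDef) {i : V} {A : Finset V} (hA : parents G i ⊆ ↑A)
    (hA' : (A : Set V) ⊆ (descendants G i)ᶜ) : condVariance (covariance L w) i A = w i := by
  have hu := isUnit_det_one_sub hG hL
  -- `z k` is the covariance of variable `k` with the error of `i`.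
  set z : V → ℝ := fun k => (covariance L w * (1 - L)) k i with hz
  have hz1 : ∀ k, z k = covariance L w k i - ∑ m, covariance L w k m * L m i := by
    intro k
    rw [hz]
    simp only
    rw [Matrix.mul_sub, Matrix.mul_one, Matrix.sub_apply, Matrix.mul_apply]
  have hz2 : ∀ k, z k = ∑ p, L p k * z p + if k = i then w i else 0 := by
    intro k
    have h1 : (1 - L).transpose * (covariance L w * (1 - L)) = Matrix.diagonal w := by
      rw [← Matrix.mul_assoc, transpose_mul_covariance hG hL, Matrix.mul_assoc,
        Matrix.nonsing_inv_mul _ hu, Matrix.mul_one]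
    have h2 := congrFun (congrFun h1 k) i
    rw [Matrix.transpose_sub, Matrix.sub_mul, Matrix.transpose_one, Matrix.one_mul,
      Matrix.sub_apply, sub_eq_iff_eq_add'] at h2
    rw [hz]
    simp only
    rw [h2, Matrix.mul_apply]
    congr 1
    by_cases hk : k = i
    · simp [hk]
    · simp [hk]
  have hz0 : ∀ k, k ∉ descendants G i → z k = 0 := by
    intro k
    induction k using hG.wellFounded_adj.induction with
    | _ k ih =>
      intro hk
      have hki : k ≠ i := by
        rintro rfl
        exact hk Relation.ReflTransGen.refl
      rw [hz2, if_neg hki, add_zero]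
      refine Finset.sum_eq_zero fun p _ => ?_
      by_cases hp : G.Adj p k
      · rw [ih p hp (notMem_descendants_of_adj hk hp), mul_zero]
      · rw [hL p k hp, zero_mul]
  have hzi : z i = w i := by
    rw [hz2, if_pos rfl, add_eq_right]
    refine Finset.sum_eq_zero fun p _ => ?_
    by_cases hp : G.Adj p i
    · rw [hz0 p (hG.notMem_descendants_of_mem_parents hp), mul_zero]
    · rw [hL p i hp, zero_mul]
  have hreg : (fun m => L m i) = regression (covariance L w) i A := by
    refine eq_regression hC (fun k hk => hL k i fun h => hk (hA h)) fun k hk => ?_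
    have := hz1 k
    rw [hz0 k (hA' hk)] at this
    linarith
  rw [condVariance_eq, ← hreg, ← hzi, hz1]

/-- A positive definite matrix that satisfies the directed local Markov property is the covariance
matrix of the model in which each variable is regressed on its parents. -/
theorem exists_eq_covariance (hG : IsDAG G) {C : Matrix V V ℝ} (hC : C.PosDef)
    {A : V → Finset V} (hA : ∀ i, (A i : Set V) = parents G i)
    (h : ∀ i j, i ≠ j → j ∉ A i → j ∉ descendants G i → (borderedSubmatrix C i j (A i)).det = 0) :
    ∃ L ∈ edgeMatrices G, (∀ i, 0 < condVariance C i (A i)) ∧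
      C = covariance L (fun i => condVariance C i (A i)) := by
  have hsymm : ∀ i j, C i j = C j i := fun i j => by simpa using hC.1.apply j i
  have hmem : ∀ i k, k ∈ A i ↔ G.Adj k i := fun i k => by
    rw [← Finset.mem_coe, hA]
    rfl
  set L : Matrix V V ℝ := fun k i => regression C i (A i) k with hLdef
  have hL : L ∈ edgeMatrices G := fun k i hk =>
    regression_of_notMem fun h' => hk ((hmem i k).1 h')
  have hCM : ∀ k i, (C * (1 - L)) k i = C k i - ∑ m, C k m * regression C i (A i) m := by
    intro k i
    rw [Matrix.mul_sub, Matrix.mul_one, Matrix.sub_apply, Matrix.mul_apply]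
  -- Residual `i` is uncorrelated with the parents of `i` by the normal equations, and with the
  -- other non-descendants by `h`.
  have hzero : ∀ i k, k ∉ descendants G i → (C * (1 - L)) k i = 0 := by
    intro i k hk
    rw [hCM, sub_eq_zero]
    by_cases hkA : k ∈ A i
    · exact (sum_mul_regression hC i hkA).symm
    · have hik : i ≠ k := by
        rintro rfl
        exact hk Relation.ReflTransGen.refl
      refine ((det_borderedSubmatrix_eq_zero_iff hC k i (A i)).1 ?_).symm
      have hT : borderedSubmatrix C k i (A i) = (borderedSubmatrix C i k (A i)).transpose := by
        ext x y
        exact hsymm _ _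
      rw [hT, Matrix.det_transpose, h i k hik hkA hk]
  have hexp : ∀ i j, ((1 - L).transpose * C * (1 - L)) i j =
      (C * (1 - L)) i j - ∑ p, L p i * (C * (1 - L)) p j := by
    intro i j
    rw [Matrix.mul_assoc, Matrix.transpose_sub, Matrix.sub_mul, Matrix.transpose_one,
      Matrix.one_mul, Matrix.sub_apply]
    rfl
  -- Residual `i` involves only `i` and its parents, none of which is a descendant of `j`.
  have hoff : ∀ i j, i ∉ descendants G j → ((1 - L).transpose * C * (1 - L)) i j = 0 := by
    intro i j hij
    rw [hexp, hzero j i hij, zero_sub, neg_eq_zero]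
    refine Finset.sum_eq_zero fun p _ => ?_
    by_cases hp : G.Adj p i
    · rw [hzero j p (notMem_descendants_of_adj hij hp), mul_zero]
    · rw [hL p i hp, zero_mul]
  have hTT : ((1 - L).transpose * C * (1 - L)).transpose = (1 - L).transpose * C * (1 - L) := by
    have : C.transpose = C := by
      ext i j
      exact hsymm j i
    rw [Matrix.transpose_mul, Matrix.transpose_mul, Matrix.transpose_transpose, this,
      Matrix.mul_assoc]
  have hdiag : ∀ i, ((1 - L).transpose * C * (1 - L)) i i = condVariance C i (A i) := by
    intro i
    rw [hexp, condVariance_eq, hCM, sub_eq_self]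
    refine Finset.sum_eq_zero fun p _ => ?_
    by_cases hp : G.Adj p i
    · rw [hzero i p (hG.notMem_descendants_of_mem_parents hp), mul_zero]
    · rw [hL p i hp, zero_mul]
  have hD : (1 - L).transpose * C * (1 - L) =
      Matrix.diagonal (fun i => condVariance C i (A i)) := by
    ext i j
    by_cases hij : i = j
    · rw [hij, Matrix.diagonal_apply_eq, hdiag]
    · rw [Matrix.diagonal_apply_ne _ hij]
      -- By acyclicity, one of two distinct nodes is not a descendant of the other, and symmetry
      -- covers both orders.
      by_cases hd : i ∈ descendants G j
      · rw [← hTT, Matrix.transpose_apply]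
        exact hoff j i (hG.notMem_descendants_symm (Ne.symm hij) hd)
      · exact hoff i j hd
  refine ⟨L, hL, fun i => ?_, eq_covariance_of_transpose_mul_mul hG hL hD⟩
  have hinj : Function.Injective (1 - L).mulVec :=
    Matrix.mulVec_injective_of_isUnit
      ((Matrix.isUnit_iff_isUnit_det _).2 (isUnit_det_one_sub hG hL))
  have hpd := hC.conjTranspose_mul_mul_same hinj
  rw [Matrix.conjTranspose_eq_transpose_of_trivial] at hpd
  rw [← hdiag]
  exact hpd.diag_pos

end Model

end PartialHomoscedastic

/-! ### The characterization. -/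

theorem theorem3p6 {V : Type*} [Fintype V] [DecidableEq V]
    (G : Digraph V) (hG : PartialHomoscedastic.IsDAG G)
    (P : Finpartition (Finset.univ : Finset V))
    (C : Matrix V V ℝ) (hC : C.PosDef) :
    C ∈ PartialHomoscedastic.model G P ↔
      (∀ (i j : V) (S : Finset V), i ≠ j → i ∉ S → j ∉ S →
        PartialHomoscedastic.DSeparated G i j S →
          (PartialHomoscedastic.borderedSubmatrix C i j S).det = 0) ∧
      (∀ (i j : V), i ≠ j → PartialHomoscedastic.SameBlock P i j →
        ∀ (A B : Finset V),
          PartialHomoscedastic.parents G i ⊆ ↑A →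
          (A : Set V) ⊆ (PartialHomoscedastic.descendants G i)ᶜ →
          PartialHomoscedastic.parents G j ⊆ ↑B →
          (B : Set V) ⊆ (PartialHomoscedastic.descendants G j)ᶜ →
          PartialHomoscedastic.condVariance C i A = PartialHomoscedastic.condVariance C j B) := by
  open PartialHomoscedastic in
  constructor
  · rintro ⟨L, hL, w, hw, hP, rfl⟩
    refine ⟨fun i j S _ hi _ h => ?_, fun i j _ hij A B hA hA' hB hB' => ?_⟩
    · exact det_borderedSubmatrix_eq_zero_of_dSeparated hG hL hw hC hi h
    · rw [condVariance_covariance hG hL hC hA hA', condVariance_covariance hG hL hC hB hB',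
        hP i j hij]
  · rintro ⟨h1, h2⟩
    classical
    have hA : ∀ i, ((parents G i).toFinset : Set V) = parents G i := fun i => Set.coe_toFinset _
    have hnd : ∀ i, ((parents G i).toFinset : Set V) ⊆ (descendants G i)ᶜ := fun i => by
      rw [hA]
      exact fun k hk => hG.notMem_descendants_of_mem_parents hk
    obtain ⟨L, hL, hw, hCL⟩ := exists_eq_covariance hG hC hA fun i j hij hjA hj =>
      h1 i j _ hij
        (fun h => hnd i h Relation.ReflTransGen.refl) hjA
        (hG.dSeparated_parents (hA i) hij hjA hj)
    refine ⟨L, hL, _, hw, fun i j hij => ?_, hCL⟩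
    by_cases hne : i = j
    · rw [hne]
    · exact h2 i j hne hij _ _ (hA i).ge (hnd i) (hA j).ge (hnd j)
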